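/- **Setting.** Graphs are finite and simple. A feedback vertex set (FVS) of a graph $G$ is a set $S\subseteq V(G)$ such that $G-S$ has no cycle; $\mathrm{OPT}(G)$ is the minimum size of an FVS. In \emph{Delayed Feedback Vertex Set} a graph $G$ with vertices $v_1,\dots,v_n$ is revealed vertex by vertex, each vertex together with its edges to earlier vertices. After every step $i$ an online algorithm must have chosen a set $S_i\subseteq\{v_1,\dots,v_i\}$ such that $G[\{v_1,\dots,v_i\}\setminus S_i]$ is cycle-free, where $S_1\subseteq\dots\subseteq S_n$; the goal is to minimize $|S_n|$. A \emph{2-3-subgraph} of $G$ is a (not necessarily induced) subgraph $H$ in which every vertex has degree 2 or 3; it is maximal if it is inclusion-maximal among the 2-3-subgraphs of $G$. A \emph{branchpoint} of $H$ is a vertex of degree 3 in $H$. A \emph{linkpoint} in $H$ is a vertex $v$ of degree 2 in $H$ such that some cycle of $G$ meets $H$ exactly in $v$. A cycle of $G$ is \emph{isolated} in $H$ if all its vertices belong to $H$ and have degree 2 in $H$. **Algorithm Online SubG-2-3.** Start with $H=\emptyset$, $F=\emptyset$. Whenever the revealed graph grows, from $G_{\mathrm{old}}$ to $G_{\mathrm{new}}$: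 1. Extend $H$ to a maximal 2-3-subgraph $H'$ of $G_{\mathrm{new}}$ (so $H'=H$ if $H$ is still maximal), giving priority to turning linkpoints into branchpoints: if some maximal 2-3-subgraph of $G_{\mathrm{new}}$ that contains $H$ has as a branchpoint a vertex that was a linkpoint in $H$ (with respect to $G_{\mathrm{old}}$), then at least one linkpoint of $H$ (with respect to $G_{\mathrm{new}}$) is a branchpoint of $H'$. 2. Add to $F$ all branchpoints of $H'$, all linkpoints in $H'$ (with respect to $G_{\mathrm{new}}$), and exactly one vertex of each new isolated cycle without linkpoints, that is, each cycle that is isolated in $H'$ in $G_{\mathrm{new}}$ and contains no linkpoint, and that was not already an isolated cycle in $H$ in $G_{\mathrm{old}}$. 3. Replace $H$ by $H'$. All remaining choices are arbitrary. **Theorem.** Let $G$ be a graph with $n$ vertices, revealed in an arbitrary order, where one iteration of the algorithm processes either one new vertex with all its edges to earlier vertices, or one new edge (the edges arriving one at a time in an arbitrary order). Then every iteration can be carried out, and for all choices the algorithm makes, the following holds. After each iteration $F$ is a set of revealed vertices (in the edge-by-edge version: of endpoints of revealed edges) that contains all earlier values of $F$ and is a feedback vertex set of the graph revealed so far; so the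 sets $F$ form a solution of Delayed Feedback Vertex Set. At the end, $$|F|\le 5\cdot\mathrm{OPT}(G)-2\quad\text{if } \mathrm{OPT}(G)\ge 1,$$ and in all cases (with $2/0$ read as $0$ if $n=0$) $$|F|\le\Bigl(5-\frac{2}{|V(G)|}\Bigr)\mathrm{OPT}(G).$$ That is, the algorithm is strictly $\bigl(5-2/|V(G)|\bigr)$-competitive. -/

import Mathlib

namespace DelayedFVS

variable {V : Type*}

/-- `S` is a feedback vertex set of `G`: deleting `S` leaves a graph without cycles. -/
def IsFVS (G : SimpleGraph V) (S : Set V) : Prop :=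
  (G.induce Sᶜ).IsAcyclic

/-- The minimum size of a feedback vertex set of `G`. -/
noncomputable def opt (G : SimpleGraph V) : ℕ :=
  sInf {k | ∃ S : Set V, IsFVS G S ∧ S.ncard = k}

/-- The degree of `v` in `H`. -/
noncomputable def deg (H : SimpleGraph V) (v : V) : ℕ :=
  (H.neighborSet v).ncard

/-- `H` is a 2-3-subgraph of `G`: a (not necessarily induced) subgraph in which every vertex has
degree 2 or 3. Such a subgraph has no isolated vertices, so it is given by its edges alone, and
its vertex set is `H.support`. -/
def IsTwoThree (G H : SimpleGraph V) : Prop :=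
  H ≤ G ∧ ∀ v ∈ H.support, deg H v = 2 ∨ deg H v = 3

/-- `H` is an inclusion-maximal 2-3-subgraph of `G`. -/
def IsMaximalTwoThree (G H : SimpleGraph V) : Prop :=
  IsTwoThree G H ∧ ∀ H' : SimpleGraph V, IsTwoThree G H' → H ≤ H' → H' = H

/-- `H'` is a maximal 2-3-subgraph of `G` that extends `H`. -/
def IsMaximalExtension (G H H' : SimpleGraph V) : Prop :=
  IsMaximalTwoThree G H' ∧ H ≤ H'

/-- `v` is a branchpoint of `H`: it has degree 3 in `H`. -/
def IsBranchpoint (H : SimpleGraph V) (v : V) : Prop :=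
  deg H v = 3

/-- `v` is a linkpoint in `H`: it has degree 2 in `H`, and some cycle of `G` meets `H` exactly
in `v`. -/
def IsLinkpoint (G H : SimpleGraph V) (v : V) : Prop :=
  deg H v = 2 ∧ ∃ C : G.Walk v v, C.IsCycle ∧ ∀ w ∈ C.support, (w ∈ H.support ↔ w = v)

/-- `Z` is the vertex set of a cycle of `G` that is isolated in `H`: all vertices of the cycle
belong to `H` and have degree 2 in `H`. -/
def IsIsolatedCycle (G H : SimpleGraph V) (Z : Set V) : Prop :=
  ∃ (v : V) (C : G.Walk v v), C.IsCycle ∧ Z = {w | w ∈ C.support} ∧ ∀ w ∈ Z, deg H w = 2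

/-- `Z` is (the vertex set of) a new isolated cycle without linkpoints, when the graph grows from
`G` to `G'` and the 2-3-subgraph from `H` to `H'`. -/
def IsNewBareCycle (G G' H H' : SimpleGraph V) (Z : Set V) : Prop :=
  IsIsolatedCycle G' H' Z ∧ ¬ IsIsolatedCycle G H Z ∧ ∀ v ∈ Z, ¬ IsLinkpoint G' H' v

/-- One iteration of the algorithm Online SubG-2-3. The revealed graph grows from `G` to `G'`,
the state of the algorithm changes from `(H, F)` to `(H', F')`.

* `H'` is a maximal 2-3-subgraph of `G'` that extends `H` (so `H' = H` if `H` is still maximal).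
* Conversion of linkpoints has priority: if some maximal extension makes a branchpoint out of a
  vertex that was a linkpoint before this iteration, then the chosen one makes a branchpoint out
  of at least one linkpoint. Every stricter rule (convert linkpoints one after the other as long
  as possible, convert an inclusion-maximal set of them, convert as many as possible) obeys this
  one.
* `F'` consists of `F`, the branchpoints, the linkpoints, and a set `I` of exactly one vertex from
  each new isolated cycle without linkpoints.

All remaining choices are arbitrary. -/
structure Step (G G' H : SimpleGraph V) (F : Set V) (H' : SimpleGraph V) (F' : Set V) : Prop where
  extend : IsMaximalExtension G' H H'
  convert_linkpoints : ∀ K : SimpleGraph V, IsMaximalExtension G' H K →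
    (∃ v, IsLinkpoint G H v ∧ IsBranchpoint K v) →
    ∃ v, IsLinkpoint G' H v ∧ IsBranchpoint H' v
  update : ∃ I : Set V,
    (∀ Z, IsNewBareCycle G G' H H' Z → ∃! v, v ∈ Z ∧ v ∈ I) ∧
    (∀ v ∈ I, ∃ Z, IsNewBareCycle G G' H H' Z ∧ v ∈ Z) ∧
    F' = F ∪ {v | IsBranchpoint H' v} ∪ {v | IsLinkpoint G' H' v} ∪ I

/-- A run of Online SubG-2-3 on the revealed graphs `Γ 0, …, Γ m`; the state after `Γ i` has been
processed is `(H i, F i)`. -/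
structure IsRun (Γ : ℕ → SimpleGraph V) (m : ℕ) (H : ℕ → SimpleGraph V) (F : ℕ → Set V) :
    Prop where
  init_graph : H 0 = ⊥
  init_set : F 0 = ∅
  step : ∀ i < m, Step (Γ i) (Γ (i + 1)) (H i) (F i) (H (i + 1)) (F (i + 1))

/-- `S` is a solution of Delayed Feedback Vertex Set, when after `i ≤ m` rounds the revealed graph
has vertex set `U i` and edges as in `Γ i`: `S i` is a set of revealed vertices, no deletion is
ever undone, and the revealed graph without `S i` is cycle-free. -/
structure IsDelayedSolution (U : ℕ → Set V) (Γ : ℕ → SimpleGraph V) (m : ℕ) (S : ℕ → Set V) :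
    Prop where
  revealed : ∀ i ≤ m, S i ⊆ U i
  irrevocable : ∀ i < m, S i ⊆ S (i + 1)
  feasible : ∀ i ≤ m, IsFVS (Γ i) (S i)

/-- The vertices revealed in the first `i` rounds, when vertices arrive in the order of `Fin n`. -/
def firstVertices (n i : ℕ) : Set (Fin n) :=
  {v | (v : ℕ) < i}

/-- The subgraph of `G` induced by the first `i` vertices (as edges on the full vertex type). -/
def vertexStage {n : ℕ} (G : SimpleGraph (Fin n)) (i : ℕ) : SimpleGraph (Fin n) where
  Adj u v := G.Adj u v ∧ u ∈ firstVertices n i ∧ v ∈ firstVertices n i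
  symm := ⟨fun _ _ h => ⟨h.1.symm, h.2.2, h.2.1⟩⟩
  loopless := ⟨fun _ h => G.irrefl h.1⟩

/-- `Γ` reveals the edges of `G` one at a time, in `m` rounds. -/
structure IsEdgewise (G : SimpleGraph V) (m : ℕ) (Γ : ℕ → SimpleGraph V) : Prop where
  init : Γ 0 = ⊥
  final : Γ m = G
  step : ∀ i < m, ∃ e ∉ (Γ i).edgeSet, (Γ (i + 1)).edgeSet = insert e (Γ i).edgeSet

/-- Online SubG-2-3, run on the presentation `(U i, Γ i)`, `i ≤ m`, of `G`, is well defined (each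
iteration can be carried out) and, whatever choices it makes, it solves Delayed Feedback Vertex Set
with strict competitive ratio `5 - 2 / |V(G)|`, indeed with at most `5 * opt G - 2` deletions
unless `G` has no cycle. -/
structure Achieves [Fintype V] (G : SimpleGraph V) (U : ℕ → Set V) (Γ : ℕ → SimpleGraph V)
    (m : ℕ) : Prop where
  progress : ∀ i < m, ∀ (H : SimpleGraph V) (F : Set V), IsTwoThree (Γ i) H →
    ∃ H' F', Step (Γ i) (Γ (i + 1)) H F H' F'
  solution : ∀ H F, IsRun Γ m H F → IsDelayedSolution U Γ m F
  ratio : ∀ H F, IsRun Γ m H F →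
    ((F m).ncard : ℝ) ≤ (5 - 2 / (Fintype.card V : ℝ)) * (opt G : ℝ)
  bound : ∀ H F, IsRun Γ m H F → 1 ≤ opt G → ((F m).ncard : ℝ) ≤ 5 * (opt G : ℝ) - 2

end DelayedFVS

namespace DelayedFVS

open SimpleGraph

/-! ### Cycle criterion for feedback vertex sets; walks as graphs -/

section Basics

variable {V : Type*}

/-! Feasibility comes from maximality of `H`: a cycle disjoint from `H`, or an ear joining two
distinct vertices of degree 2, could be added to `H`. So a cycle that avoids all branchpoints meets
`H`, either in one vertex, which is then a linkpoint, or in several, and then it lies inside `H` and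
is isolated (`IsMaximalTwoThree.isFVS`).

For the ratio, fix a feedback vertex set `S` of the final graph and put s = |S ∩ V(H)|. The final
`F` is covered by the branchpoints, the current linkpoints and a set `A` of leftovers. Branchpoints:
H - S is a forest, and all other degrees are absorbed by S, so their number is at most 2s + 2b - 2,
where b counts the branchpoints in S (`IsTwoThree.branchpoints_le`). Linkpoints: the regions outside
`H` hanging at distinct degree-2 vertices are disjoint, so each linkpoint outside S uses up its own
vertex of S outside `H` (`linkpoints_sdiff_le`). Leftovers: these are the representatives of
isolated cycles and the linkpoints that were lost without becoming branchpoints. Each iteration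
creates at most one, and only if the new `H` has a cycle disjoint from the old one; S must hit that
cycle, so s increases and |A| ≤ s (`Step.exists_charge`, `IsRun.exists_charge`). Adding up gives
5|S| - 2.

The priority rule is needed for "at most one": it prevents a new isolated cycle and a lost linkpoint
in the same iteration (`not_lost_of_new_isolated`). -/

lemma isFVS_iff_forall_isCycle {G : SimpleGraph V} {S : Set V} :
    IsFVS G S ↔ ∀ (v : V) (C : G.Walk v v), C.IsCycle → ∃ w ∈ C.support, w ∈ S := by
  constructor
  · intro h v C hC
    by_contra! hS
    have key : ∀ w ∈ C.support, w ∈ Sᶜ := hS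
    refine h (C.induce Sᶜ key) ?_
    apply Walk.IsCycle.of_map (f := (Embedding.induce Sᶜ).toHom)
    rw [Walk.map_induce]
    exact hC
  · rintro h ⟨v, hv⟩ C hC
    obtain ⟨w, hw, hwS⟩ := h _ (C.map (Embedding.induce Sᶜ).toHom)
      (hC.map (Embedding.induce (G := G) Sᶜ).injective)
    rw [Walk.support_map, List.mem_map] at hw
    obtain ⟨⟨y, hy⟩, -, rfl⟩ := hw
    exact hy hwS

/-- The edges of a walk, as a graph on all vertices. -/
def walkGraph {G : SimpleGraph V} {a b : V} (p : G.Walk a b) : SimpleGraph V :=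
  p.toSubgraph.spanningCoe

lemma walkGraph_adj {G : SimpleGraph V} {a b : V} {p : G.Walk a b} {x y : V} :
    (walkGraph p).Adj x y ↔ s(x, y) ∈ p.edges := by
  simp [walkGraph, Walk.adj_toSubgraph_iff_mem_edges]

lemma walkGraph_le {G : SimpleGraph V} {a b : V} (p : G.Walk a b) : walkGraph p ≤ G :=
  fun _ _ h => p.adj_of_mem_edges (walkGraph_adj.1 h)

lemma mem_support_of_walkGraph_adj {G : SimpleGraph V} {a b : V} {p : G.Walk a b} {x y : V}
    (h : (walkGraph p).Adj x y) : x ∈ p.support :=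
  p.fst_mem_support_of_mem_edges (walkGraph_adj.1 h)

lemma mem_support_of_walkGraph {G : SimpleGraph V} {a b v : V} {p : G.Walk a b}
    (h : v ∈ (walkGraph p).support) :
    v ∈ p.support := by
  obtain ⟨w, hw⟩ := h
  exact mem_support_of_walkGraph_adj hw

lemma deg_walkGraph_of_notMem {G : SimpleGraph V} {a b : V} {p : G.Walk a b} {x : V}
    (h : x ∉ p.support) : deg (walkGraph p) x = 0 := by
  have : (walkGraph p).neighborSet x = ∅ := by
    ext y
    simpa using fun hy => h (mem_support_of_walkGraph_adj hy)
  simp [deg, this]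

lemma deg_walkGraph_of_isCycle {G : SimpleGraph V} {a : V} {C : G.Walk a a} (hC : C.IsCycle)
    {x : V} (h : x ∈ C.support) : deg (walkGraph C) x = 2 :=
  hC.ncard_neighborSet_toSubgraph_eq_two h

lemma deg_walkGraph_start {G : SimpleGraph V} {a b : V} {p : G.Walk a b} (hp : p.IsPath)
    (hab : a ≠ b) : deg (walkGraph p) a = 1 := by
  have : (walkGraph p).neighborSet a = {p.snd} :=
    hp.neighborSet_toSubgraph_startpoint (Walk.not_nil_of_ne hab)
  simp [deg, this]

lemma deg_walkGraph_end {G : SimpleGraph V} {a b : V} {p : G.Walk a b} (hp : p.IsPath)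
    (hab : a ≠ b) : deg (walkGraph p) b = 1 := by
  have : (walkGraph p).neighborSet b = {p.penultimate} :=
    hp.neighborSet_toSubgraph_endpoint (Walk.not_nil_of_ne hab)
  simp [deg, this]

lemma deg_walkGraph_internal {G : SimpleGraph V} {a b : V} {p : G.Walk a b} (hp : p.IsPath)
    {x : V} (hx : x ∈ p.support) (hxa : x ≠ a) (hxb : x ≠ b) : deg (walkGraph p) x = 2 := by
  obtain ⟨i, rfl, hi⟩ := Walk.mem_support_iff_exists_getVert.1 hx
  refine hp.ncard_neighborSet_toSubgraph_internal_eq_two ?_ ?_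
  · rintro rfl
    simp at hxa
  · refine lt_of_le_of_ne hi ?_
    rintro rfl
    simp at hxb

lemma walk_mem_iff {G : SimpleGraph V} {Z : Set V} {a b : V} (p : G.Walk a b)
    (h : ∀ x y, s(x, y) ∈ p.edges → x ∈ Z → y ∈ Z) :
    ∀ x ∈ p.support, (x ∈ Z ↔ a ∈ Z) := by
  induction p with
  | nil => simp
  | @cons u v w e p ih =>
    have huv : v ∈ Z ↔ u ∈ Z :=
      ⟨h v u (by simp [Sym2.eq_swap]), h u v (by simp)⟩
    intro x hx
    rw [Walk.support_cons, List.mem_cons] at hx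
    rcases hx with rfl | hx
    · rfl
    · rw [ih (fun x y hxy => h x y (by simp [hxy])) x hx, huv]

lemma exists_path_to_set {G : SimpleGraph V} {Z : Set V} {a b : V} (p : G.Walk a b)
    (hp : p.IsPath) (hb : b ∈ Z) :
    ∃ (z : V) (q : G.Walk a z), q.IsPath ∧ z ∈ Z ∧ q.support ⊆ p.support ∧
      ∀ y ∈ q.support, y ∈ Z → y = z := by
  induction p with
  | nil => exact ⟨_, .nil, by simp, hb, by simp, by simp⟩
  | @cons u v w e p ih =>
    by_cases hu : u ∈ Z
    · exact ⟨u, .nil, by simp, hu, by simp, by simp⟩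
    · rw [Walk.cons_isPath_iff] at hp
      obtain ⟨z, q, hq, hz, hs, hy⟩ := ih hp.1 hb
      refine ⟨z, .cons e q, ?_, hz, ?_, ?_⟩
      · rw [Walk.cons_isPath_iff]
        exact ⟨hq, fun h => hp.2 (hs h)⟩
      · intro y hyy
        simp only [Walk.support_cons, List.mem_cons] at hyy ⊢
        exact hyy.imp_right fun h => hs h
      · intro y hyy hyZ
        simp only [Walk.support_cons, List.mem_cons] at hyy
        rcases hyy with rfl | hyy
        · exact absurd hyZ hu
        · exact hy y hyy hyZ

/-- An edge lies in `H` only if both its ends do, so a walk that meets `H` in at most one vertex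
uses no edge of `H`. -/
lemma edges_notMem_of_meets_once {G H : SimpleGraph V} {a b u : V} (p : G.Walk a b)
    (h : ∀ y ∈ p.support, y ∈ H.support → y = u) : ∀ e ∈ p.edges, e ∉ H.edgeSet := by
  intro e he heH
  induction e with
  | _ x y =>
    have hxy : H.Adj x y := heH
    have hx := h x (p.fst_mem_support_of_mem_edges he) ⟨y, hxy⟩
    have hy := h y (p.snd_mem_support_of_mem_edges he) ⟨x, hxy.symm⟩
    exact hxy.ne (hx.trans hy.symm)

lemma IsTwoThree.two_le {G H : SimpleGraph V} (hH : IsTwoThree G H) {v : V}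
    (hv : v ∈ H.support) : 2 ≤ deg H v := by
  have := hH.2 v hv
  omega

end Basics

/-! ### Enlarging a 2-3-subgraph by a cycle or an ear -/

section Degrees

variable {V : Type*} [Finite V] {G H K : SimpleGraph V}

lemma deg_mono (h : H ≤ K) (v : V) : deg H v ≤ deg K v :=
  Set.ncard_le_ncard (fun _ hb => h hb) (Set.toFinite _)

lemma deg_pos_iff {v : V} : 0 < deg H v ↔ v ∈ H.support := by
  rw [deg, Set.ncard_pos]
  rfl

lemma mem_support_of_deg {v : V} {k : ℕ} (h : deg H v = k + 1) : v ∈ H.support :=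
  deg_pos_iff.1 (by omega)

lemma deg_eq_zero {v : V} (h : v ∉ H.support) : deg H v = 0 := by
  have := mt deg_pos_iff.1 h
  omega

lemma deg_sup (v : V) (h : ∀ b, H.Adj v b → ¬ K.Adj v b) :
    deg (H ⊔ K) v = deg H v + deg K v := by
  have : (H ⊔ K).neighborSet v = H.neighborSet v ∪ K.neighborSet v := by
    ext b
    simp
  rw [deg, this, Set.ncard_union_eq _ (Set.toFinite _) (Set.toFinite _)]
  · rfl
  · exact Set.disjoint_left.2 fun b hb hb' => h b hb hb'

lemma adj_of_deg_le (h : H ≤ K) {v b : V} (hd : deg K v ≤ deg H v) (hb : K.Adj v b) :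
    H.Adj v b := by
  have : H.neighborSet v = K.neighborSet v :=
    Set.eq_of_subset_of_ncard_le (fun _ hb => h hb) hd (Set.toFinite _)
  have hb' : b ∈ K.neighborSet v := hb
  rw [← this] at hb'
  exact hb'

lemma IsTwoThree.deg_le (hH : IsTwoThree G H) (v : V) : deg H v ≤ 3 := by
  by_cases hv : v ∈ H.support
  · have := hH.2 v hv
    omega
  · rw [deg_eq_zero hv]
    omega

lemma IsTwoThree.sup (hH : IsTwoThree G H) (hK : K ≤ G)
    (hdisj : ∀ a b, H.Adj a b → ¬ K.Adj a b)
    (h1 : ∀ v ∈ K.support, v ∈ H.support → deg H v = 2 ∧ deg K v = 1)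
    (h2 : ∀ v ∈ K.support, v ∉ H.support → deg K v = 2 ∨ deg K v = 3) :
    IsTwoThree G (H ⊔ K) := by
  refine ⟨sup_le hH.1 hK, fun v hv => ?_⟩
  rw [deg_sup v (hdisj v)]
  by_cases hvH : v ∈ H.support
  · by_cases hvK : v ∈ K.support
    · have := h1 v hvK hvH
      omega
    · rw [deg_eq_zero hvK]
      exact hH.2 v hvH
  · rw [deg_eq_zero hvH]
    by_cases hvK : v ∈ K.support
    · have := h2 v hvK hvH
      omega
    · obtain ⟨b, hb⟩ := hv
      rcases hb with hb | hb
      · exact absurd ⟨b, hb⟩ hvH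
      · exact absurd ⟨b, hb⟩ hvK

lemma IsTwoThree.sup_cycle (hH : IsTwoThree G H) {a : V} {C : G.Walk a a} (hC : C.IsCycle)
    (hdisj : ∀ v ∈ C.support, v ∉ H.support) : IsTwoThree G (H ⊔ walkGraph C) := by
  refine hH.sup (walkGraph_le C) ?_ ?_ ?_
  · exact fun x y h h' => hdisj x (mem_support_of_walkGraph_adj h') ⟨y, h⟩
  · exact fun v hv hv' => absurd hv' (hdisj v (mem_support_of_walkGraph hv))
  · exact fun v hv _ => Or.inl (deg_walkGraph_of_isCycle hC (mem_support_of_walkGraph hv))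

lemma IsTwoThree.sup_path (hH : IsTwoThree G H) {a b : V} (hab : a ≠ b) {p : G.Walk a b}
    (hp : p.IsPath) (ha : deg H a = 2) (hb : deg H b = 2)
    (hint : ∀ v ∈ p.support, v ∈ H.support → v = a ∨ v = b)
    (he : ∀ e ∈ p.edges, e ∉ H.edgeSet) :
    IsTwoThree G (H ⊔ walkGraph p) ∧ deg (H ⊔ walkGraph p) a = 3 := by
  have hdisj : ∀ x y, H.Adj x y → ¬ (walkGraph p).Adj x y :=
    fun x y h h' => he _ (walkGraph_adj.1 h') h
  refine ⟨hH.sup (walkGraph_le p) hdisj ?_ ?_, ?_⟩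
  · intro v hv hv'
    rcases hint v (mem_support_of_walkGraph hv) hv' with rfl | rfl
    · exact ⟨ha, deg_walkGraph_start hp hab⟩
    · exact ⟨hb, deg_walkGraph_end hp hab⟩
  · intro v hv hv'
    refine Or.inl (deg_walkGraph_internal hp (mem_support_of_walkGraph hv) ?_ ?_)
    · rintro rfl
      exact hv' (mem_support_of_deg ha)
    · rintro rfl
      exact hv' (mem_support_of_deg hb)
  · rw [deg_sup a (hdisj a), ha, deg_walkGraph_start hp hab]

lemma IsMaximalTwoThree.exists_mem_of_isCycle (hH : IsMaximalTwoThree G H) {a : V}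
    {C : G.Walk a a} (hC : C.IsCycle) : ∃ v ∈ C.support, v ∈ H.support := by
  by_contra! h
  have heq := hH.2 _ (hH.1.sup_cycle hC h) le_sup_left
  refine h a C.start_mem_support ?_
  rw [← heq, ← deg_pos_iff]
  have := deg_mono (le_sup_right : walkGraph C ≤ H ⊔ walkGraph C) a
  rw [deg_walkGraph_of_isCycle hC C.start_mem_support] at this
  omega

/-- Otherwise the walk contains an ear with two distinct ends of degree 2, and adding it raises both
to degree 3. This is the main way in which maximality is used. -/
lemma IsMaximalTwoThree.eq_of_walk (hH : IsMaximalTwoThree G H) {a b : V} (p : G.Walk a b)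
    (ha : deg H a = 2) (hb : deg H b = 2)
    (hint : ∀ v ∈ p.support, v ∈ H.support → v = a ∨ v = b)
    (he : ∀ e ∈ p.edges, e ∉ H.edgeSet) : a = b := by
  classical
  by_contra hab
  obtain ⟨h23, h3⟩ := hH.1.sup_path hab p.bypass_isPath ha hb
    (fun v hv => hint v (p.support_bypass_subset_support hv))
    (fun e h => he e (p.edges_bypass_sublist_edges.subset h))
  rw [hH.2 _ h23 le_sup_left] at h3
  omega

lemma IsMaximalTwoThree.adj_of_deg_two (hH : IsMaximalTwoThree G H) {a b : V} (hab : G.Adj a b)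
    (ha : deg H a = 2) (hb : deg H b = 2) : H.Adj a b := by
  by_contra h
  refine hab.ne (hH.eq_of_walk (.cons hab .nil) ha hb ?_ ?_)
  · intro v hv _
    simpa using hv
  · intro e he
    simp only [Walk.edges_cons, Walk.edges_nil, List.mem_singleton] at he
    subst he
    exact h

/-- Cut the path at its vertices in `H`. A piece with no inner vertex in `H` would be an ear unless
it uses an edge of `H`; that edge joins the ends of the piece and hence is the whole piece. -/
lemma IsMaximalTwoThree.edges_mem_of_isPath (hH : IsMaximalTwoThree G H) (n : ℕ) :
    ∀ {a b : V} (p : G.Walk a b), p.length ≤ n → p.IsPath → a ∈ H.support → b ∈ H.support →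
      (∀ v ∈ p.support, v ∈ H.support → deg H v = 2) → ∀ e ∈ p.edges, e ∈ H.edgeSet := by
  classical
  induction n with
  | zero =>
    intro a b p hn _ _ _ _ e he
    have := List.length_pos_of_mem he
    rw [Walk.length_edges] at this
    omega
  | succ n ih =>
    intro a b p hn hp ha hb hdeg e he
    by_cases hmid : ∃ z ∈ p.support, z ∈ H.support ∧ z ≠ a ∧ z ≠ b
    · obtain ⟨z, hz, hzH, hza, hzb⟩ := hmid
      have hlen := congrArg Walk.length (p.take_spec hz)
      rw [Walk.length_append] at hlen
      have h1 : 0 < (p.takeUntil z hz).length :=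
        Walk.not_nil_iff_lt_length.1 (Walk.not_nil_of_ne hza.symm)
      have h2 : 0 < (p.dropUntil z hz).length :=
        Walk.not_nil_iff_lt_length.1 (Walk.not_nil_of_ne hzb)
      rw [← p.take_spec hz, Walk.edges_append, List.mem_append] at he
      rcases he with he | he
      · exact ih _ (by omega) (hp.takeUntil hz) ha hzH
          (fun v hv => hdeg v (p.support_takeUntil_subset_support hz hv)) e he
      · exact ih _ (by omega) (hp.dropUntil hz) hzH hb
          (fun v hv => hdeg v (p.support_dropUntil_subset_support hz hv)) e he
    · push Not at hmid
      by_contra heH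
      have hint : ∀ v ∈ p.support, v ∈ H.support → v = a ∨ v = b := by
        intro v hv hvH
        by_cases hva : v = a
        · exact Or.inl hva
        · exact Or.inr (hmid v hv hvH hva)
      have hab : a ≠ b := by
        rintro rfl
        rw [Walk.isPath_iff_nil.1 hp |>.eq_nil] at he
        simp at he
      by_cases hall : ∀ e ∈ p.edges, e ∉ H.edgeSet
      · exact hab (hH.eq_of_walk p (hdeg a p.start_mem_support ha) (hdeg b p.end_mem_support hb)
          hint hall)
      · push Not at hall
        obtain ⟨f, hf, hfH⟩ := hall
        have hfab : f = s(a, b) := by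
          induction f with
          | _ x y =>
            have hxy : H.Adj x y := hfH
            have hx := hint x (p.fst_mem_support_of_mem_edges hf) ⟨y, hxy⟩
            have hy := hint y (p.snd_mem_support_of_mem_edges hf) ⟨x, hxy.symm⟩
            have hne := hxy.ne
            rcases hx with rfl | rfl <;> rcases hy with rfl | rfl
            · exact absurd rfl hne
            · rfl
            · exact Sym2.eq_swap
            · exact absurd rfl hne
        subst hfab
        cases p with
        | nil => exact hab rfl
        | cons h q =>
          have hsnd := hp.snd_of_toSubgraph_adj (Walk.adj_toSubgraph_iff_mem_edges.2 hf)
          rw [Walk.snd_cons] at hsnd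
          subst hsnd
          have hq := (Walk.isPath_iff_nil.1 ((Walk.cons_isPath_iff _ _).1 hp).1).eq_nil
          subst hq
          simp only [Walk.edges_cons, Walk.edges_nil, List.mem_singleton] at he
          exact heH (he ▸ hfH)

end Degrees

/-! ### Edge count of a forest; regions outside `H` -/

section Reach

variable {V : Type*} {G H : SimpleGraph V}

open Classical in
lemma forest_degree_sum (H : SimpleGraph V) (U : Finset V) (hU : U.Nonempty)
    (hac : (H.induce (U : Set V)).IsAcyclic) :
    ∑ v ∈ U, (U.filter (H.Adj v)).card + 2 ≤ 2 * U.card := by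
  have : Nonempty (U : Set V) := hU.to_subtype
  -- The forest is extended to a spanning tree of the complete graph on `U`, which has |U| - 1
  -- edges.
  obtain ⟨T, hle, -, hT⟩ := (connected_top (V := (U : Set V))).exists_isTree_le_of_le_of_isAcyclic
    le_top hac
  have h1 := hT.card_edgeFinset
  have h2 := Finset.card_le_card (edgeFinset_mono hle)
  have h3 := (H.induce (U : Set V)).sum_degrees_eq_twice_card_edges
  have h4 : ∑ v ∈ U, (U.filter (H.Adj v)).card =
      ∑ v : (U : Set V), (H.induce (U : Set V)).degree v := by
    rw [← Finset.sum_coe_sort U]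
    refine Finset.sum_congr rfl fun v _ => ?_
    rw [← card_neighborFinset_eq_degree]
    symm
    refine Finset.card_bij (fun w _ => (w : V)) ?_ ?_ ?_
    · intro w hw
      simpa using hw
    · intro w _ w' _ h
      exact Subtype.ext h
    · intro w hw
      rw [Finset.mem_filter] at hw
      exact ⟨⟨w, hw.1⟩, by simpa using hw.2, rfl⟩
  have h5 : Fintype.card (U : Set V) = U.card := by simp
  omega

/-- The vertices outside `H` that can be reached from `u` in `G` without meeting `H` again. -/
def reach (G H : SimpleGraph V) (u : V) : Set V :=
  {t | t ∉ H.support ∧ ∃ p : G.Walk u t, ∀ y ∈ p.support, y ∈ H.support → y = u}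

lemma reach_of_adj {u a b : V} (ha : a ∈ reach G H u) (hab : G.Adj a b) (hb : b ∉ H.support) :
    b ∈ reach G H u := by
  obtain ⟨-, p, hp⟩ := ha
  refine ⟨hb, p.concat hab, fun y hy hyH => ?_⟩
  rw [Walk.support_concat, List.mem_append] at hy
  rcases hy with hy | hy
  · exact hp y hy hyH
  · rw [List.mem_singleton] at hy
    exact absurd (hy ▸ hyH) hb

lemma mem_reach_of_cycle {u w : V} {C : G.Walk u u}
    (hC : ∀ w ∈ C.support, (w ∈ H.support ↔ w = u)) (hw : w ∈ C.support) (hwu : w ≠ u) :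
    w ∈ reach G H u := by
  classical
  exact ⟨fun h => hwu ((hC w hw).1 h), C.takeUntil w hw, fun y hy =>
    (hC y (C.support_takeUntil_subset_support hw hy)).1⟩

end Reach

/-! ### Consequences of maximality: feasibility, isolated cycles, disjoint regions -/

section Static

variable {V : Type*} [Finite V] {G H : SimpleGraph V}

lemma IsMaximalTwoThree.isFVS (hH : IsMaximalTwoThree G H) {F : Set V}
    (hB : ∀ v, IsBranchpoint H v → v ∈ F) (hL : ∀ v, IsLinkpoint G H v → v ∈ F)
    (hZ : ∀ Z, IsIsolatedCycle G H Z → ∃ v ∈ Z, v ∈ F) : IsFVS G F := by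
  classical
  rw [isFVS_iff_forall_isCycle]
  intro a C hC
  by_contra! hF
  have hdeg : ∀ v ∈ C.support, v ∈ H.support → deg H v = 2 := fun v hv hvH =>
    (hH.1.2 v hvH).resolve_right fun h => hF v hv (hB v h)
  obtain ⟨v, hv, hvH⟩ := hH.exists_mem_of_isCycle hC
  have hC' : (C.rotate v hv).IsCycle := hC.rotate hv
  have hsupp : ∀ w, w ∈ (C.rotate v hv).support → w ∈ C.support := fun w hw =>
    (Walk.mem_support_rotate_iff ..).1 hw
  generalize C.rotate v hv = D at hC' hsupp
  by_cases hw : ∃ w ∈ D.support, w ∈ H.support ∧ w ≠ v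
  · obtain ⟨w, hw, hwH, hwv⟩ := hw
    have h1 : ∀ e ∈ (D.takeUntil w hw).edges, e ∈ H.edgeSet :=
      hH.edges_mem_of_isPath _ _ le_rfl (hC'.isPath_takeUntil hw) hvH hwH fun y hy =>
        hdeg y (hsupp y (D.support_takeUntil_subset_support hw hy))
    have h2 : ∀ e ∈ (D.dropUntil w hw).edges, e ∈ H.edgeSet := by
      refine hH.edges_mem_of_isPath _ _ le_rfl ?_ hwH hvH fun y hy =>
        hdeg y (hsupp y (D.support_dropUntil_subset_support hw hy))
      refine Walk.IsCycle.isPath_of_append_right (p := D.takeUntil w hw)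
        (Walk.not_nil_of_ne hwv.symm) ?_
      rwa [Walk.take_spec]
    have hall : ∀ e ∈ D.edges, e ∈ H.edgeSet := by
      intro e he
      rw [← D.take_spec hw, Walk.edges_append, List.mem_append] at he
      exact he.elim (h1 e) (h2 e)
    obtain ⟨z, hz, hzF⟩ := hZ {w | w ∈ D.support} ⟨v, D, hC', rfl, fun z hz => by
      obtain ⟨e, he, hze⟩ := (Walk.mem_support_iff_exists_mem_edges_of_not_nil hC'.not_nil).1 hz
      obtain ⟨y, rfl⟩ := hze
      exact hdeg z (hsupp z hz) ⟨y, hall _ he⟩⟩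
    exact hF z (hsupp z hz) hzF
  · push Not at hw
    refine hF v hv (hL v ⟨hdeg v hv hvH, D, hC', fun w hwD => ⟨hw w hwD, ?_⟩⟩)
    rintro rfl
    exact hvH

/-- `IsIsolatedCycle` asks only that the vertices lie in `H`. Maximality supplies the edges, so
isolated cycles are components of `H` and are disjoint or equal. -/
lemma IsMaximalTwoThree.walkGraph_le_of_isolated (hH : IsMaximalTwoThree G H) {v : V}
    {C : G.Walk v v} (hd : ∀ w ∈ C.support, deg H w = 2) : walkGraph C ≤ H := by
  intro a b hab
  exact hH.adj_of_deg_two (walkGraph_le C hab) (hd a (mem_support_of_walkGraph_adj hab))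
    (hd b (mem_support_of_walkGraph_adj hab.symm))

lemma IsMaximalTwoThree.mem_of_adj_of_isolated (hH : IsMaximalTwoThree G H) {Z : Set V}
    (hZ : IsIsolatedCycle G H Z) {a b : V} (ha : a ∈ Z) (hab : H.Adj a b) : b ∈ Z := by
  obtain ⟨v, C, hC, rfl, hd⟩ := hZ
  have := adj_of_deg_le (hH.walkGraph_le_of_isolated hd) (v := a) (b := b)
    (by rw [hd a ha, deg_walkGraph_of_isCycle hC ha]) hab
  exact mem_support_of_walkGraph_adj this.symm

lemma IsMaximalTwoThree.isolated_subset (hH : IsMaximalTwoThree G H) {Z Z' : Set V}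
    (hZ : IsIsolatedCycle G H Z) (hZ' : IsIsolatedCycle G H Z') {v : V} (hv : v ∈ Z)
    (hv' : v ∈ Z') : Z' ⊆ Z := by
  obtain ⟨w, C, hC, rfl, hd⟩ := hZ'
  have key := walk_mem_iff (Z := Z) C fun x y hxy hx =>
    hH.mem_of_adj_of_isolated hZ hx (hH.walkGraph_le_of_isolated hd (walkGraph_adj.2 hxy))
  exact fun y hy => (key y hy).2 ((key v hv').1 hv)

lemma IsMaximalTwoThree.isolated_eq (hH : IsMaximalTwoThree G H) {Z Z' : Set V}
    (hZ : IsIsolatedCycle G H Z) (hZ' : IsIsolatedCycle G H Z') {v : V} (hv : v ∈ Z)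
    (hv' : v ∈ Z') : Z = Z' :=
  (hH.isolated_subset hZ' hZ hv' hv).antisymm (hH.isolated_subset hZ hZ' hv hv')

lemma IsMaximalTwoThree.reach_disjoint (hH : IsMaximalTwoThree G H) {u w t : V}
    (hu : deg H u = 2) (hw : deg H w = 2) (htu : t ∈ reach G H u) (htw : t ∈ reach G H w) :
    u = w := by
  obtain ⟨-, p, hp⟩ := htu
  obtain ⟨-, q, hq⟩ := htw
  refine hH.eq_of_walk (p.append q.reverse) hu hw ?_ ?_
  · intro y hy hyH
    rw [Walk.mem_support_append_iff, Walk.support_reverse, List.mem_reverse] at hy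
    exact hy.imp (fun h => hp y h hyH) (fun h => hq y h hyH)
  · intro e he
    rw [Walk.edges_append, Walk.edges_reverse, List.mem_append, List.mem_reverse] at he
    exact he.elim (edges_notMem_of_meets_once p hp e) (edges_notMem_of_meets_once q hq e)

lemma IsMaximalTwoThree.eq_of_reach_adj (hH : IsMaximalTwoThree G H) {u a b : V}
    (hu : deg H u = 2) (hb : deg H b = 2) (ha : a ∈ reach G H u) (hab : G.Adj a b) : b = u := by
  refine (hH.reach_disjoint hu hb ha ⟨ha.1, .cons hab.symm .nil, fun y hy hyH => ?_⟩).symm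
  simp only [Walk.support_cons, Walk.support_nil, List.mem_cons, List.not_mem_nil,
    or_false] at hy
  rcases hy with rfl | rfl
  · rfl
  · exact absurd hyH ha.1

end Static

/-- The revealed graph grows from `G` to `G'` by edges at the single vertex `x`, and by at most one
edge if `x` already had edges. -/
structure Growth {V : Type*} (G G' : SimpleGraph V) (x : V) : Prop where
  le : G ≤ G'
  new_edge : ∀ a b, G'.Adj a b → ¬ G.Adj a b → a = x ∨ b = x
  single : x ∈ G.support → ∃ y, ∀ b, G'.Adj x b → ¬ G.Adj x b → b = y

/-! ### One iteration: lost linkpoints and new isolated cycles -/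

section Dynamic

variable {V : Type*} [Finite V] {G G' H H' : SimpleGraph V} {x : V}

lemma exists_maximal_extension (hH : IsTwoThree G H) : ∃ K, IsMaximalExtension G H K := by
  obtain ⟨K, hle, hK⟩ := Finite.exists_le_maximal (p := IsTwoThree G) hH
  exact ⟨K, ⟨hK.1, fun K' hK' hKK' => (hK.2 hK' hKK').antisymm hKK'⟩, hle⟩

open Classical in
-- If `X` contained no cycle, the vertices with a neighbour in `X` would induce a forest with degree
-- sum at most 2|U| - 2. Degrees of at least 2, with the one exception `x`, give at least 2|U| - 1.
lemma exists_isCycle_in (K : SimpleGraph V) (X : Set V) (x : V)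
    (hX : ∀ v ∈ X, v ≠ x → ∀ b, K.Adj v b → b ∈ X)
    (hd : ∀ v ∈ X, v ≠ x → v ∈ K.support → 2 ≤ deg K v)
    (he : ∃ a ∈ X, ∃ b ∈ X, K.Adj a b) :
    ∃ (v : V) (C : K.Walk v v), C.IsCycle ∧ ∀ w ∈ C.support, w ∈ X := by
  have := Fintype.ofFinite V
  by_contra! hno
  let U : Finset V := Finset.univ.filter fun v => v ∈ X ∧ ∃ b ∈ X, K.Adj v b
  have hU : U.Nonempty := by
    obtain ⟨a, ha, b, hb, hab⟩ := he
    exact ⟨a, by simpa [U] using ⟨ha, b, hb, hab⟩⟩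
  have hac : (K.induce (U : Set V)).IsAcyclic := by
    have : IsFVS K (U : Set V)ᶜ := by
      rw [isFVS_iff_forall_isCycle]
      intro v C hC
      obtain ⟨w, hw, hwX⟩ := hno v C hC
      exact ⟨w, hw, fun h => hwX (by simpa [U] using And.left (by simpa [U] using h))⟩
    rwa [IsFVS, compl_compl] at this
  have hsum := forest_degree_sum K U hU hac
  have hlow : ∀ v ∈ U, (if v = x then 1 else 2) ≤ (U.filter (K.Adj v)).card := by
    intro v hv
    have hv' : v ∈ X ∧ ∃ b ∈ X, K.Adj v b := by simpa [U] using hv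
    obtain ⟨hvX, b, hbX, hvb⟩ := hv'
    split_ifs with hvx
    · refine Finset.card_pos.2 ⟨b, ?_⟩
      rw [Finset.mem_filter]
      exact ⟨by simpa [U] using ⟨hbX, v, hvX, hvb.symm⟩, hvb⟩
    · refine (hd v hvX hvx ⟨b, hvb⟩).trans ?_
      rw [deg, ← Set.ncard_coe_finset]
      refine Set.ncard_le_ncard (fun c hc => ?_) (Set.toFinite _)
      have hvc : K.Adj v c := hc
      rw [Finset.mem_coe, Finset.mem_filter]
      exact ⟨by simpa [U] using ⟨hX v hvX hvx c hvc, v, hvX, hvc.symm⟩, hvc⟩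
  have h1 := Finset.sum_le_sum hlow
  have h2 : ∑ v ∈ U, (if v = x then 1 else 2) + 1 ≥ 2 * U.card := by
    have h3 : ∑ v ∈ U, ((if v = x then 1 else 2) + if v = x then 1 else 0) = ∑ v ∈ U, 2 :=
      Finset.sum_congr rfl fun v _ => by split_ifs <;> rfl
    rw [Finset.sum_add_distrib, Finset.sum_const, smul_eq_mul] at h3
    have h4 : ∑ v ∈ U, (if v = x then 1 else 0) ≤ 1 := by
      rw [Finset.sum_ite_eq']
      split_ifs <;> omega
    omega
  omega

lemma exists_new_adj {v : V} (h2 : deg H v = 2) (h3 : deg H' v = 3) :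
    ∃ b, H'.Adj v b ∧ ¬ H.Adj v b := by
  by_contra! h
  have := Set.ncard_le_ncard (s := H'.neighborSet v) (t := H.neighborSet v)
    (fun b hb => h b hb) (Set.toFinite _)
  change deg H' v ≤ deg H v at this
  omega

/-- A linkpoint that is not converted but lost loses its cycle to the new part of `H'`. -/
lemma exists_mem_of_lost (hGG' : G ≤ G') {u : V} {C : G.Walk u u} (hC : C.IsCycle)
    (hCu : ∀ w ∈ C.support, (w ∈ H.support ↔ w = u)) (hu' : deg H' u = 2)
    (hlost : ¬ IsLinkpoint G' H' u) :
    ∃ w ∈ C.support, w ≠ u ∧ w ∈ H'.support ∧ w ∉ H.support := by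
  by_contra! h
  refine hlost ⟨hu', C.mapLe hGG', hC.mapLe hGG', fun w hw => ?_⟩
  rw [Walk.support_mapLe_eq_support] at hw
  refine ⟨fun hwH => ?_, ?_⟩
  · by_contra hwu
    exact hwu ((hCu w hw).1 (h w hw hwu hwH))
  · rintro rfl
    exact mem_support_of_deg hu'

/-- The new part of `H'` enters the region of `u` but cannot leave it except through `x`, so it
closes a cycle there, and this cycle passes through `x`. -/
lemma lost_spec (hg : Growth G G' x) (hH : IsMaximalTwoThree G H) (hH' : IsTwoThree G' H')
    (hle : H ≤ H') {u : V} (hu' : deg H' u = 2) (hlink : IsLinkpoint G H u)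
    (hlost : ¬ IsLinkpoint G' H' u) :
    (∃ (v : V) (C : H'.Walk v v), C.IsCycle ∧ ∀ w ∈ C.support, w ∉ H.support) ∧
      2 ≤ {y | y ∈ reach G H u ∧ H'.Adj x y}.ncard := by
  obtain ⟨hu, C, hC, hCu⟩ := hlink
  obtain ⟨w, hwC, hwu, hwH', hwH⟩ := exists_mem_of_lost hg.le hC hCu hu' hlost
  have hw : w ∈ reach G H u := mem_reach_of_cycle hCu hwC hwu
  have hout : ∀ v ∈ reach G H u, ∀ b, H'.Adj v b → G.Adj v b → b ∈ reach G H u := by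
    intro v hv b hvb hvb'
    refine reach_of_adj hv hvb' fun hb => ?_
    have hnot : ¬ H.Adj b v := fun h => hv.1 ⟨b, h.symm⟩
    have hlt : deg H b < deg H' b := by
      by_contra hge
      exact hnot (adj_of_deg_le hle (not_lt.1 hge) hvb.symm)
    have h3 := hH'.deg_le b
    have h2 := hH.1.two_le hb
    have hbu : b = u := hH.eq_of_reach_adj hu (by omega) hv hvb'
    subst hbu
    omega
  have hclosed : ∀ v ∈ insert x (reach G H u), v ≠ x → ∀ b, H'.Adj v b →
      b ∈ insert x (reach G H u) := by
    intro v hv hvx b hvb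
    by_cases hbx : b = x
    · exact Or.inl hbx
    · refine Or.inr (hout v (hv.resolve_left hvx) b hvb ?_)
      by_contra hG
      exact (hg.new_edge v b (hH'.1 hvb) hG).elim hvx hbx
  have hedge : ∃ a ∈ insert x (reach G H u), ∃ b ∈ insert x (reach G H u), H'.Adj a b := by
    by_cases hwx : w = x
    · subst hwx
      obtain ⟨e, he, hwe⟩ := (Walk.mem_support_iff_exists_mem_edges_of_not_nil hC.not_nil).1 hwC
      obtain ⟨z, rfl⟩ := hwe
      -- Here `x` lies on the old cycle, so it receives at most one new edge. Having degree at least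
      -- 2 in `H'`, it also uses an old edge, which stays in the region.
      obtain ⟨y, hy⟩ := hg.single ⟨z, C.adj_of_mem_edges he⟩
      obtain ⟨b, hb, hby⟩ : ∃ b, H'.Adj w b ∧ b ≠ y := by
        by_contra! hall
        have h1 := hH'.two_le hwH'
        have h2 := Set.ncard_le_ncard (s := H'.neighborSet w) (t := {y})
          (fun b hb => hall b hb) (Set.toFinite _)
        rw [Set.ncard_singleton] at h2
        exact absurd (h1.trans h2) (by omega)
      refine ⟨w, Or.inl rfl, b, Or.inr (hout w hw b hb ?_), hb⟩
      by_contra hG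
      exact hby (hy b (hH'.1 hb) hG)
    · obtain ⟨b, hb⟩ := hwH'
      exact ⟨w, Or.inr hw, b, hclosed w (Or.inr hw) hwx b hb, hb⟩
  obtain ⟨v, Q, hQ, hQX⟩ := exists_isCycle_in H' (insert x (reach G H u)) x hclosed
    (fun v _ _ hv => hH'.two_le hv) hedge
  -- Without `x` this would be a cycle of `G` disjoint from `H`.
  have hxQ : x ∈ Q.support := by
    by_contra hxQ
    have hQG : ∀ e ∈ Q.edges, e ∈ G.edgeSet := by
      intro e he
      induction e with
      | _ a b =>
        by_contra hG
        rcases hg.new_edge a b (hH'.1 (Q.adj_of_mem_edges he)) hG with rfl | rfl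
        · exact hxQ (Q.fst_mem_support_of_mem_edges he)
        · exact hxQ (Q.snd_mem_support_of_mem_edges he)
    obtain ⟨y, hy, hyH⟩ := hH.exists_mem_of_isCycle (hQ.transfer hQG)
    rw [Walk.support_transfer] at hy
    rcases hQX y hy with rfl | hyr
    · exact hxQ hy
    · exact hyr.1 hyH
  have hcard : 2 ≤ {y | y ∈ reach G H u ∧ H'.Adj x y}.ncard := by
    rw [← deg_walkGraph_of_isCycle hQ hxQ]
    refine Set.ncard_le_ncard (fun y hy => ?_) (Set.toFinite _)
    have hxy : (walkGraph Q).Adj x y := hy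
    refine ⟨(hQX y (mem_support_of_walkGraph_adj hxy.symm)).resolve_left hxy.ne', ?_⟩
    exact walkGraph_le Q hxy
  refine ⟨⟨v, Q, hQ, fun y hy hyH => ?_⟩, hcard⟩
  rcases hQX y hy with rfl | hyr
  -- If `x` were in `H`, two old neighbours and two in the region would give it degree 4 in `H'`.
  · have h2 := hH.1.two_le hyH
    have hdisj : Disjoint (H.neighborSet y) {z | z ∈ reach G H u ∧ H'.Adj y z} :=
      Set.disjoint_left.2 fun z hz hz' => hz'.1.1 ⟨y, Adj.symm hz⟩
    have h3 := Set.ncard_union_eq hdisj (Set.toFinite _) (Set.toFinite _)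
    have h4 := Set.ncard_le_ncard (t := H'.neighborSet y)
      (Set.union_subset (fun z hz => hle hz) (fun z hz => hz.2) :
        H.neighborSet y ∪ {z | z ∈ reach G H u ∧ H'.Adj y z} ⊆ H'.neighborSet y) (Set.toFinite _)
    have h5 := hH'.deg_le y
    unfold deg at h2 h5
    omega
  · exact hyr.1 hyH

/-- Two lost linkpoints would need two neighbours of `x` in each of two disjoint regions, but `x`
has degree at most 3. -/
lemma lost_unique (hg : Growth G G' x) (hH : IsMaximalTwoThree G H) (hH' : IsTwoThree G' H')
    (hle : H ≤ H') {u w : V} (hu' : deg H' u = 2) (hlink : IsLinkpoint G H u)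
    (hlost : ¬ IsLinkpoint G' H' u) (hw' : deg H' w = 2) (hlinkw : IsLinkpoint G H w)
    (hlostw : ¬ IsLinkpoint G' H' w) : u = w := by
  by_contra hne
  have h1 := (lost_spec hg hH hH' hle hu' hlink hlost).2
  have h2 := (lost_spec hg hH hH' hle hw' hlinkw hlostw).2
  have hdisj : Disjoint {y | y ∈ reach G H u ∧ H'.Adj x y} {y | y ∈ reach G H w ∧ H'.Adj x y} :=
    Set.disjoint_left.2 fun y hy hy' =>
      hne (hH.reach_disjoint hlink.1 hlinkw.1 hy.1 hy'.1)
  have h3 := Set.ncard_union_eq hdisj (Set.toFinite _) (Set.toFinite _)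
  have h4 := Set.ncard_le_ncard (t := H'.neighborSet x)
    (Set.union_subset (fun z hz => hz.2) (fun z hz => hz.2) :
      {y | y ∈ reach G H u ∧ H'.Adj x y} ∪ {y | y ∈ reach G H w ∧ H'.Adj x y} ⊆
        H'.neighborSet x) (Set.toFinite _)
  have h5 := hH'.deg_le x
  unfold deg at h5
  omega

/-- A vertex of the cycle that is in `H` already has both its cycle edges in `H`. This propagates
around the cycle, which would then be an old isolated cycle. -/
lemma new_isolated_disjoint (hGG' : IsTwoThree G H) (hH' : IsMaximalTwoThree G' H') (hle : H ≤ H')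
    {Z : Set V} (hZ : IsIsolatedCycle G' H' Z) (hnew : ¬ IsIsolatedCycle G H Z) :
    ∀ z ∈ Z, z ∉ H.support := by
  obtain ⟨v, C, hC, rfl, hd⟩ := hZ
  intro z hz hzH
  have hCH' := hH'.walkGraph_le_of_isolated hd
  have hadj : ∀ a b, s(a, b) ∈ C.edges → a ∈ H.support → H.Adj a b := by
    intro a b hab ha
    refine adj_of_deg_le hle ?_ (hCH' (walkGraph_adj.2 hab))
    rw [hd a (C.fst_mem_support_of_mem_edges hab)]
    exact hGG'.two_le ha
  have hall := walk_mem_iff (Z := H.support) C fun a b hab ha => ⟨a, (hadj a b hab ha).symm⟩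
  have hsupp : ∀ y ∈ C.support, y ∈ H.support := fun y hy =>
    (hall y hy).2 ((hall z hz).1 hzH)
  have hCG : ∀ e ∈ C.edges, e ∈ G.edgeSet := by
    intro e he
    induction e with
    | _ a b => exact hGG'.1 (hadj a b he (hsupp a (C.fst_mem_support_of_mem_edges he)))
  refine hnew ⟨v, C.transfer G hCG, hC.transfer hCG, by rw [Walk.support_transfer], fun y hy => ?_⟩
  have h1 := hd y hy
  have h2 := deg_mono hle y
  have h3 := hGG'.two_le (hsupp y hy)
  omega

lemma new_isolated_mem (hg : Growth G G' x) (hH : IsMaximalTwoThree G H)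
    (hH' : IsMaximalTwoThree G' H') (hle : H ≤ H') {Z : Set V} (hZ : IsIsolatedCycle G' H' Z)
    (hnew : ¬ IsIsolatedCycle G H Z) : x ∈ Z := by
  have hdisj := new_isolated_disjoint hH.1 hH' hle hZ hnew
  obtain ⟨v, C, hC, rfl, hd⟩ := hZ
  by_contra hx
  have hCG : ∀ e ∈ C.edges, e ∈ G.edgeSet := by
    intro e he
    induction e with
    | _ a b =>
      by_contra hG
      rcases hg.new_edge a b (C.adj_of_mem_edges he) hG with rfl | rfl
      · exact hx (C.fst_mem_support_of_mem_edges he)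
      · exact hx (C.snd_mem_support_of_mem_edges he)
  obtain ⟨y, hy, hyH⟩ := hH.exists_mem_of_isCycle (hC.transfer hCG)
  rw [Walk.support_transfer] at hy
  exact hdisj y hy hyH

/-- The new part of `H'` is the new isolated cycle alone. -/
lemma mem_new_isolated_of_adj (hg : Growth G G' x) (hH : IsMaximalTwoThree G H)
    (hH' : IsMaximalTwoThree G' H') (hle : H ≤ H') {Z : Set V} (hZ : IsIsolatedCycle G' H' Z)
    (hnew : ¬ IsIsolatedCycle G H Z) {a b : V} (hab : H'.Adj a b) (hab' : ¬ H.Adj a b) :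
    a ∈ Z := by
  have hdisj := new_isolated_disjoint hH.1 hH' hle hZ hnew
  have hx := new_isolated_mem hg hH hH' hle hZ hnew
  by_contra ha
  have hmem : ∀ {c d}, c ∉ Z → H'.Adj c d → d ∉ Z := fun hc hcd hd =>
    hc (hH'.mem_of_adj_of_isolated hZ hd hcd.symm)
  -- `H'` without the component `Z` avoids `x`, so it is a 2-3-subgraph of `G` containing `H` and
  -- equals `H` by maximality.
  let K : SimpleGraph V :=
    { Adj := fun c d => H'.Adj c d ∧ c ∉ Z ∧ d ∉ Z
      symm := ⟨fun _ _ h => ⟨h.1.symm, h.2.2, h.2.1⟩⟩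
      loopless := ⟨fun _ h => H'.irrefl h.1⟩ }
  have hK : IsTwoThree G K := by
    constructor
    · intro c d hcd
      by_contra hG
      rcases hg.new_edge c d (hH'.1.1 hcd.1) hG with rfl | rfl
      · exact hcd.2.1 hx
      · exact hcd.2.2 hx
    · rintro c ⟨d, hcd⟩
      have : K.neighborSet c = H'.neighborSet c := by
        ext e
        exact ⟨fun h => h.1, fun h => ⟨h, hcd.2.1, hmem hcd.2.1 h⟩⟩
      rw [deg, this]
      exact hH'.1.2 c ⟨d, hcd.1⟩
  have hHK : H ≤ K := fun c d hcd =>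
    ⟨hle hcd, fun h => hdisj c h ⟨d, hcd⟩, fun h => hdisj d h ⟨c, hcd.symm⟩⟩
  have heq := hH.2 K hK hHK
  apply hab'
  rw [← heq]
  exact ⟨hab, ha, hmem ha hab⟩

/-- If `u` were lost, its cycle would meet `Z`. Adding to `H` the cycle `Z` and a path from `u` to
`Z` would convert `u`, so the priority rule forces a conversion in `H'`. But all new edges of `H'`
lie on `Z`, away from `H`. -/
lemma not_lost_of_new_isolated {F F' : Set V} (hg : Growth G G' x) (hH : IsMaximalTwoThree G H)
    (hstep : Step G G' H F H' F') {Z : Set V} (hZ : IsIsolatedCycle G' H' Z)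
    (hnew : ¬ IsIsolatedCycle G H Z) {u : V} (hu' : deg H' u = 2) (hlink : IsLinkpoint G H u) :
    IsLinkpoint G' H' u := by
  classical
  obtain ⟨hH', hle⟩ := hstep.extend
  by_contra hlost
  have hadj := fun {a b} => mem_new_isolated_of_adj (a := a) (b := b) hg hH hH' hle hZ hnew
  have hdisj := new_isolated_disjoint hH.1 hH' hle hZ hnew
  have hlink' := hlink
  obtain ⟨hu, C, hC, hCu⟩ := hlink
  obtain ⟨w, hwC, hwu, ⟨y, hwy⟩, hwH⟩ := exists_mem_of_lost hg.le hC hCu hu' hlost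
  have hwZ : w ∈ Z := hadj hwy fun h => hwH ⟨y, h⟩
  obtain ⟨z, q, hq, hz, hqs, hqz⟩ :=
    exists_path_to_set (C.takeUntil w hwC) (hC.isPath_takeUntil hwC) hwZ
  have hqH : ∀ y ∈ q.support, y ∈ H.support → y = u := fun y hy =>
    (hCu y (C.support_takeUntil_subset_support hwC (hqs hy))).1
  have huH : u ∈ H.support := mem_support_of_deg hu
  obtain ⟨v, D, hD, rfl, hd⟩ := hZ
  have hHG' : IsTwoThree G' H := ⟨hH.1.1.trans hg.le, hH.1.2⟩
  have h1 := hHG'.sup_cycle hD hdisj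
  have hne : u ≠ z := by
    rintro rfl
    exact hdisj u hz huH
  have hdu : deg (H ⊔ walkGraph D) u = 2 := by
    rw [deg_sup, hu, deg_walkGraph_of_notMem fun h => hdisj u h huH]
    exact fun b _ hb => hdisj u (mem_support_of_walkGraph_adj hb) huH
  have hdz : deg (H ⊔ walkGraph D) z = 2 := by
    rw [deg_sup, deg_eq_zero (hdisj z hz), deg_walkGraph_of_isCycle hD hz]
    exact fun b hb _ => hdisj z hz ⟨b, hb⟩
  obtain ⟨h2, h3⟩ := h1.sup_path hne (p := q.mapLe hg.le) (hq.mapLe hg.le) hdu hdz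
    (by
      rw [Walk.support_mapLe_eq_support]
      rintro y hy ⟨b, hb | hb⟩
      · exact Or.inl (hqH y hy ⟨b, hb⟩)
      · exact Or.inr (hqz y hy (mem_support_of_walkGraph_adj hb)))
    (by
      rw [Walk.edges_mapLe_eq_edges]
      intro e he heH
      rw [edgeSet_sup] at heH
      rcases heH with heH | heH
      · exact edges_notMem_of_meets_once q hqH e he heH
      · exact edges_notMem_of_meets_once (H := walkGraph D) q
          (fun y hy hyD => hqz y hy (mem_support_of_walkGraph hyD)) e he heH)
  obtain ⟨K, hK, hleK⟩ := exists_maximal_extension h2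
  have huK : deg K u = 3 := by
    have h4 := deg_mono hleK u
    have h5 := hK.1.deg_le u
    omega
  obtain ⟨v, hv, hv'⟩ := hstep.convert_linkpoints K
    ⟨hK, le_sup_left.trans (le_sup_left.trans hleK)⟩ ⟨u, hlink', huK⟩
  obtain ⟨b, hb, hb'⟩ := exists_new_adj hv.1 hv'
  exact hdisj v (hadj hb hb') (mem_support_of_deg hv.1)

lemma Step.exists_charge {F F' : Set V} (hg : Growth G G' x) (hH : IsMaximalTwoThree G H)
    (hstep : Step G G' H F H' F') :
    ∃ A : Set V, F' ⊆ F ∪ {v | IsBranchpoint H' v} ∪ {v | IsLinkpoint G' H' v} ∪ A ∧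
      (∀ v, IsLinkpoint G H v → IsBranchpoint H' v ∨ IsLinkpoint G' H' v ∨ v ∈ A) ∧
      (A = ∅ ∨ A.ncard ≤ 1 ∧
        ∃ (v : V) (C : H'.Walk v v), C.IsCycle ∧ ∀ w ∈ C.support, w ∉ H.support) := by
  obtain ⟨hH', hle⟩ := hstep.extend
  obtain ⟨I, hI1, hI2, rfl⟩ := hstep.update
  -- The second set consists of the lost linkpoints: they stay in `F` although neither branchpoint
  -- nor linkpoint now.
  refine ⟨I ∪ {v | deg H' v = 2 ∧ IsLinkpoint G H v ∧ ¬ IsLinkpoint G' H' v}, ?_, ?_, ?_⟩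
  · exact Set.union_subset_union_right _ Set.subset_union_left
  · intro v hv
    by_cases hl : IsLinkpoint G' H' v
    · exact Or.inr (Or.inl hl)
    · have h1 := deg_mono hle v
      have h2 := hH'.1.deg_le v
      rw [hv.1] at h1
      rcases (show deg H' v = 2 ∨ deg H' v = 3 by omega) with h | h
      · exact Or.inr (Or.inr (Or.inr ⟨h, hv, hl⟩))
      · exact Or.inl h
  · rcases Set.eq_empty_or_nonempty
      (I ∪ {v | deg H' v = 2 ∧ IsLinkpoint G H v ∧ ¬ IsLinkpoint G' H' v}) with h | ⟨a, ha⟩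
    · exact Or.inl h
    · refine Or.inr ⟨?_, ?_⟩
      · rw [Set.ncard_le_one (Set.toFinite _)]
        rintro a (ha | ⟨ha1, ha2, ha3⟩) b (hb | ⟨hb1, hb2, hb3⟩)
        · obtain ⟨Z, hZ, haZ⟩ := hI2 a ha
          obtain ⟨Z', hZ', hbZ⟩ := hI2 b hb
          have hx := new_isolated_mem hg hH hH' hle hZ.1 hZ.2.1
          have hx' := new_isolated_mem hg hH hH' hle hZ'.1 hZ'.2.1
          have heq := hH'.isolated_eq hZ.1 hZ'.1 hx hx'
          subst heq
          exact (hI1 Z hZ).unique ⟨haZ, ha⟩ ⟨hbZ, hb⟩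
        · obtain ⟨Z, hZ, -⟩ := hI2 a ha
          exact absurd (not_lost_of_new_isolated hg hH hstep hZ.1 hZ.2.1 hb1 hb2) hb3
        · obtain ⟨Z, hZ, -⟩ := hI2 b hb
          exact absurd (not_lost_of_new_isolated hg hH hstep hZ.1 hZ.2.1 ha1 ha2) ha3
        · exact lost_unique hg hH hH'.1 hle ha1 ha2 ha3 hb1 hb2 hb3
      · rcases ha with ha | ⟨ha1, ha2, ha3⟩
        · obtain ⟨Z, hZ, -⟩ := hI2 a ha
          have hdisj := new_isolated_disjoint hH.1 hH' hle hZ.1 hZ.2.1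
          obtain ⟨⟨v, C, hC, rfl, hd⟩, -⟩ := hZ
          have hCH : ∀ e ∈ C.edges, e ∈ H'.edgeSet := by
            intro e he
            induction e with
            | _ c d => exact hH'.walkGraph_le_of_isolated hd (walkGraph_adj.2 he)
          refine ⟨v, C.transfer H' hCH, hC.transfer hCH, fun w hw => ?_⟩
          rw [Walk.support_transfer] at hw
          exact hdisj w hw
        · exact (lost_spec hg hH hH'.1 hle ha1 ha2 ha3).1

lemma exists_step (hGG' : G ≤ G') (hH : IsTwoThree G H) (F : Set V) :
    ∃ H' F', Step G G' H F H' F' := by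
  obtain ⟨H', hext, hconv⟩ : ∃ H', IsMaximalExtension G' H H' ∧
      ∀ K, IsMaximalExtension G' H K → (∃ v, IsLinkpoint G H v ∧ IsBranchpoint K v) →
        ∃ v, IsLinkpoint G' H v ∧ IsBranchpoint H' v := by
    by_cases h : ∃ K, IsMaximalExtension G' H K ∧ ∃ v, IsLinkpoint G H v ∧ IsBranchpoint K v
    · obtain ⟨K, hK, v, ⟨hv2, C, hC, hCv⟩, hv'⟩ := h
      -- A linkpoint of `H` in `G` is still one in `G'`, so the extension that triggers the rule
      -- also obeys it.
      refine ⟨K, hK, fun _ _ _ => ⟨v, ⟨hv2, C.mapLe hGG', hC.mapLe hGG', ?_⟩, hv'⟩⟩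
      rwa [Walk.support_mapLe_eq_support]
    · obtain ⟨K, hK⟩ := exists_maximal_extension (G := G') ⟨hH.1.trans hGG', hH.2⟩
      exact ⟨K, hK, fun K' hK' hv => absurd ⟨K', hK', hv⟩ h⟩
  have hne : ∀ Z, IsNewBareCycle G G' H H' Z → ∃ v, v ∈ Z := by
    rintro Z ⟨⟨v, C, -, rfl, -⟩, -⟩
    exact ⟨v, C.start_mem_support⟩
  choose f hf using hne
  refine ⟨H', _, hext, hconv, {v | ∃ Z, ∃ hZ : IsNewBareCycle G G' H H' Z, f Z hZ = v}, ?_, ?_, rfl⟩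
  · intro Z hZ
    refine ⟨f Z hZ, ⟨hf Z hZ, Z, hZ, rfl⟩, ?_⟩
    rintro _ ⟨hv, Z', hZ', rfl⟩
    obtain rfl := hext.1.isolated_eq hZ.1 hZ'.1 hv (hf Z' hZ')
    rfl
  · rintro _ ⟨Z, hZ, rfl⟩
    exact ⟨Z, hZ, hf Z hZ⟩

end Dynamic

/-! ### Optimal solutions and the soundness invariant -/

section General

variable {V : Type*} {G H : SimpleGraph V}

lemma IsFVS.induce_isAcyclic {S : Set V} (hS : IsFVS G S) (hle : H ≤ G) {U : Set V}
    (hU : U ⊆ Sᶜ) : (H.induce U).IsAcyclic := by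
  have : IsFVS H Uᶜ := by
    rw [isFVS_iff_forall_isCycle] at hS ⊢
    intro v C hC
    obtain ⟨w, hw, hwS⟩ := hS v (C.mapLe hle) (hC.mapLe hle)
    rw [Walk.support_mapLe_eq_support] at hw
    exact ⟨w, hw, fun h => hU h hwS⟩
  rwa [IsFVS, compl_compl] at this

lemma exists_isFVS_ncard_eq_opt (G : SimpleGraph V) : ∃ S, IsFVS G S ∧ S.ncard = opt G := by
  have hne : {k | ∃ S : Set V, IsFVS G S ∧ S.ncard = k}.Nonempty :=
    ⟨_, Set.univ, isFVS_iff_forall_isCycle.2 fun v C _ => ⟨v, C.start_mem_support, trivial⟩, rfl⟩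
  exact Nat.sInf_mem hne

/-- What holds of the state of the algorithm after every iteration. -/
structure IsSound (G H : SimpleGraph V) (F : Set V) : Prop where
  maximal : IsMaximalTwoThree G H
  subset : F ⊆ H.support
  branchpoint : ∀ v, IsBranchpoint H v → v ∈ F
  linkpoint : ∀ v, IsLinkpoint G H v → v ∈ F
  isolated : ∀ Z, IsIsolatedCycle G H Z → ∃ v ∈ Z, v ∈ F

lemma isSound_bot : IsSound (⊥ : SimpleGraph V) ⊥ ∅ := by
  have hdeg : ∀ v, deg (⊥ : SimpleGraph V) v = 0 := fun v => by simp [deg]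
  refine ⟨⟨⟨le_rfl, fun v hv => ?_⟩, fun K hK _ => le_bot_iff.1 hK.1⟩, Set.empty_subset _,
    fun v hv => ?_, fun v hv => ?_, ?_⟩
  · simp at hv
  · rw [IsBranchpoint, hdeg] at hv
    omega
  · have := hv.1
    rw [hdeg] at this
    omega
  · rintro _ ⟨v, C, hC, rfl, hd⟩
    have := hd v C.start_mem_support
    rw [hdeg] at this
    omega

lemma le_final {Γ : ℕ → SimpleGraph V} {m : ℕ}
    (hg : ∀ i < m, ∃ x, Growth (Γ i) (Γ (i + 1)) x) (k : ℕ) :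
    ∀ i, i + k = m → Γ i ≤ Γ m := by
  induction k with
  | zero =>
    rintro i rfl
    exact le_rfl
  | succ k ih =>
    intro i hi
    obtain ⟨x, hx⟩ := hg i (by omega)
    exact hx.le.trans (ih (i + 1) (by omega))

end General

/-! ### Counting against a feedback vertex set -/

section Count

variable {V : Type*} [Finite V] {G H : SimpleGraph V}

open Classical in
/-- Deleting a feedback vertex set leaves a forest, which bounds the number of branchpoints. -/
lemma IsTwoThree.branchpoints_le (hH : IsTwoThree G H) {S : Set V} (hS : IsFVS G S)
    (hne : ¬ H.support ⊆ S) :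
    {v | IsBranchpoint H v}.ncard + 2 ≤
      2 * (S ∩ H.support).ncard + 2 * (S ∩ {v | IsBranchpoint H v}).ncard := by
  have := Fintype.ofFinite V
  let U : Finset V := Finset.univ.filter fun v => v ∈ H.support ∧ v ∉ S
  let P : Finset V := Finset.univ.filter fun v => v ∈ S ∧ v ∈ H.support
  have hU : U.Nonempty := by
    obtain ⟨v, hv, hvS⟩ := Set.not_subset.1 hne
    exact ⟨v, by simpa [U] using ⟨hv, hvS⟩⟩
  have hforest := forest_degree_sum H U hU
    (hS.induce_isAcyclic hH.1 fun v hv => by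
      have : v ∈ H.support ∧ v ∉ S := by simpa [U] using hv
      exact this.2)
  have hdeg : ∀ v, deg H v = (U.filter (H.Adj v)).card + (P.filter (H.Adj v)).card := by
    intro v
    rw [← Finset.card_union_of_disjoint, ← Set.ncard_coe_finset, deg]
    · congr 1
      ext b
      simp only [mem_neighborSet, Finset.coe_union, Finset.coe_filter, Set.mem_union,
        Set.mem_ofPred_eq, U, P, Finset.mem_filter, Finset.mem_univ, true_and]
      constructor
      · intro h
        have hb : b ∈ H.support := ⟨v, h.symm⟩
        by_cases hbS : b ∈ S
        · exact Or.inr ⟨⟨hbS, hb⟩, h⟩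
        · exact Or.inl ⟨⟨hb, hbS⟩, h⟩
      · rintro (h | h) <;> exact h.2
    · rw [Finset.disjoint_left]
      intro b hb hb'
      simp only [U, P, Finset.mem_filter, Finset.mem_univ, true_and] at hb hb'
      exact hb.1.2 hb'.1.1
  have hswap : ∑ v ∈ U, (P.filter (H.Adj v)).card = ∑ v ∈ P, (U.filter (H.Adj v)).card := by
    have := Finset.sum_card_bipartiteAbove_eq_sum_card_bipartiteBelow (s := U) (t := P) H.Adj
    simp only [Finset.bipartiteAbove, Finset.bipartiteBelow] at this
    rw [this]
    simp only [H.adj_comm]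
  have hval : ∀ v ∈ H.support, deg H v = 2 + if IsBranchpoint H v then 1 else 0 := by
    intro v hv
    unfold IsBranchpoint
    rcases hH.2 v hv with h | h <;> simp [h]
  have hsum : ∀ X : Finset V, (∀ v ∈ X, v ∈ H.support) →
      ∑ v ∈ X, deg H v = 2 * X.card + (X.filter (IsBranchpoint H)).card := by
    intro X hX
    rw [Finset.sum_congr rfl fun v hv => hval v (hX v hv), Finset.sum_add_distrib,
      Finset.sum_const, smul_eq_mul, mul_comm, Finset.card_filter]
  have hsU := hsum U fun v hv => by
    have : v ∈ H.support ∧ v ∉ S := by simpa [U] using hv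
    exact this.1
  have hsP := hsum P fun v hv => by
    have : v ∈ S ∧ v ∈ H.support := by simpa [P] using hv
    exact this.2
  have hUsum : ∑ v ∈ U, deg H v =
      ∑ v ∈ U, (U.filter (H.Adj v)).card + ∑ v ∈ U, (P.filter (H.Adj v)).card := by
    rw [← Finset.sum_add_distrib]
    exact Finset.sum_congr rfl fun v _ => hdeg v
  have hPsum : ∑ v ∈ P, (U.filter (H.Adj v)).card ≤ ∑ v ∈ P, deg H v :=
    Finset.sum_le_sum fun v _ => by
      rw [hdeg v]
      omega
  have hPcard : (S ∩ H.support).ncard = P.card := by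
    rw [← Set.ncard_coe_finset]
    congr 1
    ext v
    simp [P]
  have hPB : (S ∩ {v | IsBranchpoint H v}).ncard = (P.filter (IsBranchpoint H)).card := by
    rw [← Set.ncard_coe_finset]
    congr 1
    ext v
    have : IsBranchpoint H v → v ∈ H.support := fun h => mem_support_of_deg h
    simp only [Set.mem_inter_iff, Set.mem_ofPred_eq, P, Finset.coe_filter, Finset.mem_filter,
      Finset.mem_univ, true_and]
    tauto
  have hB : {v | IsBranchpoint H v}.ncard =
      (U.filter (IsBranchpoint H)).card + (P.filter (IsBranchpoint H)).card := by
    rw [← Finset.card_union_of_disjoint, ← Set.ncard_coe_finset]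
    · congr 1
      ext v
      have : IsBranchpoint H v → v ∈ H.support := fun h => mem_support_of_deg h
      simp only [Set.mem_ofPred_eq, U, P, Finset.coe_union, Finset.coe_filter, Finset.mem_filter,
        Finset.mem_univ, true_and, Set.mem_union]
      tauto
    · rw [Finset.disjoint_left]
      intro b hb hb'
      simp only [U, P, Finset.mem_filter, Finset.mem_univ, true_and] at hb hb'
      exact hb.1.2 hb'.1.1
  -- The terms 2|U| cancel: branchpoints in `U`, plus 2, are at most the edges between `U` and `P`,
  -- hence at most 2|P| plus the branchpoints in `P`.
  omega

/-- Linkpoints outside a feedback vertex set need vertices of it outside `H`. -/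
lemma IsMaximalTwoThree.linkpoints_sdiff_le (hH : IsMaximalTwoThree G H) {S : Set V}
    (hS : IsFVS G S) : ({v | IsLinkpoint G H v} \ S).ncard ≤ (S \ H.support).ncard := by
  have hex : ∀ v, ∃ t, v ∈ {v | IsLinkpoint G H v} \ S → t ∈ S ∧ t ∈ reach G H v := by
    intro v
    by_cases hv : v ∈ {v | IsLinkpoint G H v} \ S
    · obtain ⟨⟨_, C, hC, hCv⟩, hvS⟩ := hv
      obtain ⟨t, ht, htS⟩ := isFVS_iff_forall_isCycle.1 hS v C hC
      refine ⟨t, fun _ => ⟨htS, mem_reach_of_cycle hCv ht ?_⟩⟩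
      rintro rfl
      exact hvS htS
    · exact ⟨v, fun h => absurd h hv⟩
  choose f hf using hex
  refine Set.ncard_le_ncard_of_injOn f (fun v hv => ⟨(hf v hv).1, (hf v hv).2.1⟩) ?_
    (Set.toFinite _)
  intro v hv w hw hvw
  refine hH.reach_disjoint hv.1.1 hw.1.1 (hf v hv).2 ?_
  rw [hvw]
  exact (hf w hw).2

lemma IsMaximalTwoThree.ncard_le (hH : IsMaximalTwoThree G H) {F S A : Set V}
    (hF : F ⊆ H.support) (hS : IsFVS G S)
    (hFA : F ⊆ {v | IsBranchpoint H v} ∪ {v | IsLinkpoint G H v} ∪ A)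
    (hA : A.ncard ≤ (S ∩ H.support).ncard) :
    F.ncard + 2 ≤ 5 * S.ncard ∨ F.ncard ≤ S.ncard := by
  -- The saving of 2 needs a nonempty forest H - S.
  by_cases hne : H.support ⊆ S
  · exact Or.inr (Set.ncard_le_ncard (hF.trans hne) (Set.toFinite _))
  · refine Or.inl ?_
    have h1 := hH.1.branchpoints_le hS hne
    have h2 := hH.linkpoints_sdiff_le hS
    have h3 := Set.ncard_le_ncard hFA (Set.toFinite _)
    have h4 := Set.ncard_union_le ({v | IsBranchpoint H v} ∪ {v | IsLinkpoint G H v}) A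
    have h5 := Set.ncard_union_le {v | IsBranchpoint H v} {v | IsLinkpoint G H v}
    have h6 := Set.ncard_inter_add_ncard_sdiff_eq_ncard {v | IsLinkpoint G H v} S (Set.toFinite _)
    have h7 := Set.ncard_inter_add_ncard_sdiff_eq_ncard S H.support (Set.toFinite _)
    have hdisj : Disjoint ({v | IsLinkpoint G H v} ∩ S) (S ∩ {v | IsBranchpoint H v}) :=
      Set.disjoint_left.2 fun v hv hv' => by
        have h2 : deg H v = 2 := hv.1.1
        have h3 : deg H v = 3 := hv'.2
        omega
    have h8 := Set.ncard_union_eq hdisj (Set.toFinite _) (Set.toFinite _)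
    have h9 : (({v | IsLinkpoint G H v} ∩ S) ∪ (S ∩ {v | IsBranchpoint H v})).ncard ≤
        (S ∩ H.support).ncard := by
      refine Set.ncard_le_ncard ?_ (Set.toFinite _)
      rintro v (hv | hv)
      · exact ⟨hv.2, mem_support_of_deg hv.1.1⟩
      · exact ⟨hv.1, mem_support_of_deg hv.2⟩
    -- With s = |S ∩ V(H)| and b, l the branchpoints and linkpoints in S: |F| ≤ (2s + 2b - 2) + (l +
    -- |S| - s) + s, where b + l ≤ s ≤ |S|.
    omega

end Count

/-! ### Invariants along a run -/

section Run

variable {V : Type*} [Finite V] {Γ : ℕ → SimpleGraph V} {m : ℕ} {H : ℕ → SimpleGraph V}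
  {F : ℕ → Set V}

lemma Step.isSound {G G' K K' : SimpleGraph V} {S S' : Set V} (h : IsSound G K S)
    (hstep : Step G G' K S K' S') : IsSound G' K' S' := by
  obtain ⟨hK', hle⟩ := hstep.extend
  obtain ⟨I, hI1, hI2, rfl⟩ := hstep.update
  have hlink : ∀ v, IsLinkpoint G' K' v → v ∈ S ∪ {v | IsBranchpoint K' v} ∪
      {v | IsLinkpoint G' K' v} ∪ I := fun v hv => Or.inl (Or.inr hv)
  refine ⟨hK', ?_, fun v hv => Or.inl (Or.inl (Or.inr hv)), hlink, ?_⟩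
  · rintro v (((hv | hv) | hv) | hv)
    · obtain ⟨w, hw⟩ := h.subset hv
      exact ⟨w, hle hw⟩
    · exact mem_support_of_deg hv
    · exact mem_support_of_deg hv.1
    · obtain ⟨Z, ⟨⟨_, C, -, rfl, hd⟩, -⟩, hvZ⟩ := hI2 v hv
      exact mem_support_of_deg (hd v hvZ)
  · intro Z hZ
    by_cases hold : IsIsolatedCycle G K Z
    · obtain ⟨v, hvZ, hv⟩ := h.isolated Z hold
      exact ⟨v, hvZ, Or.inl (Or.inl (Or.inl hv))⟩
    · by_cases hl : ∃ v ∈ Z, IsLinkpoint G' K' v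
      · obtain ⟨v, hvZ, hv⟩ := hl
        exact ⟨v, hvZ, hlink v hv⟩
      · push Not at hl
        obtain ⟨v, ⟨hvZ, hv⟩, -⟩ := hI1 Z ⟨hZ, hold, hl⟩
        exact ⟨v, hvZ, Or.inr hv⟩

lemma IsSound.isFVS {G K : SimpleGraph V} {S : Set V} (h : IsSound G K S) : IsFVS G S :=
  h.maximal.isFVS h.branchpoint h.linkpoint h.isolated

lemma IsRun.isSound (h0 : Γ 0 = ⊥) (hrun : IsRun Γ m H F) :
    ∀ i ≤ m, IsSound (Γ i) (H i) (F i) := by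
  intro i
  induction i with
  | zero =>
    intro _
    rw [h0, hrun.init_graph, hrun.init_set]
    exact isSound_bot
  | succ i ih => exact fun hi => (hrun.step i hi).isSound (ih (by omega))

lemma IsRun.exists_charge (h0 : Γ 0 = ⊥) (hg : ∀ i < m, ∃ x, Growth (Γ i) (Γ (i + 1)) x)
    (hrun : IsRun Γ m H F) {S : Set V} (hS : IsFVS (Γ m) S) :
    ∀ i ≤ m, ∃ A : Set V, F i ⊆ {v | IsBranchpoint (H i) v} ∪ {v | IsLinkpoint (Γ i) (H i) v} ∪ A ∧
      A.ncard ≤ (S ∩ (H i).support).ncard := by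
  intro i
  induction i with
  | zero =>
    intro _
    refine ⟨∅, ?_, by simp⟩
    rw [hrun.init_set]
    exact Set.empty_subset _
  | succ i ih =>
    intro hi
    obtain ⟨A, hFA, hA⟩ := ih (by omega)
    obtain ⟨x, hx⟩ := hg i hi
    have hsound := hrun.isSound h0 i (by omega)
    have hsound' := hrun.isSound h0 (i + 1) hi
    have hstep := hrun.step i hi
    obtain ⟨A', hF', hlink, hA'⟩ := hstep.exists_charge hx hsound.maximal
    have hle := hstep.extend.2
    have hsupp : (H i).support ⊆ (H (i + 1)).support := fun v ⟨w, hw⟩ => ⟨w, hle hw⟩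
    refine ⟨A ∪ A', ?_, ?_⟩
    · intro v hv
      rcases hF' hv with ((hv | hv) | hv) | hv
      · rcases hFA hv with (hv | hv) | hv
        · refine Or.inl (Or.inl ?_)
          have h1 := deg_mono hle v
          have h2 := hsound'.maximal.1.deg_le v
          have h3 : deg (H i) v = 3 := hv
          change deg (H (i + 1)) v = 3
          omega
        · rcases hlink v hv with h | h | h
          · exact Or.inl (Or.inl h)
          · exact Or.inl (Or.inr h)
          · exact Or.inr (Or.inr h)
        · exact Or.inr (Or.inl hv)
      · exact Or.inl (Or.inl hv)
      · exact Or.inl (Or.inr hv)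
      · exact Or.inr (Or.inr hv)
    · rcases hA' with rfl | ⟨hcard, v, C, hC, hdisj⟩
      · rw [Set.union_empty]
        exact hA.trans (Set.ncard_le_ncard (Set.inter_subset_inter_right S hsupp) (Set.toFinite _))
      · have hleG : H (i + 1) ≤ Γ m :=
          hsound'.maximal.1.1.trans (le_final hg (m - (i + 1)) (i + 1) (by omega))
        obtain ⟨w, hw, hwS⟩ := isFVS_iff_forall_isCycle.1 hS v (C.mapLe hleG) (hC.mapLe hleG)
        rw [Walk.support_mapLe_eq_support] at hw
        have hwH : w ∈ (H (i + 1)).support := by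
          rw [← deg_pos_iff]
          have := deg_mono (walkGraph_le C) w
          rw [deg_walkGraph_of_isCycle hC hw] at this
          omega
        -- The vertex of `S` on the cycle disjoint from the old `H` pays for the one new leftover.
        have hlt : (S ∩ (H i).support).ncard < (S ∩ (H (i + 1)).support).ncard :=
          Set.ncard_lt_ncard ⟨Set.inter_subset_inter_right S hsupp,
            fun h => hdisj w hw (h ⟨hwS, hwH⟩).2⟩ (Set.toFinite _)
        have := Set.ncard_union_le A A'
        omega

end Run

/-! ### The ratio, and the two ways of revealing the graph -/

lemma achieves_of_growth {V : Type*} [Fintype V] {G : SimpleGraph V} {U : ℕ → Set V}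
    {Γ : ℕ → SimpleGraph V} {m : ℕ} (h0 : Γ 0 = ⊥) (hm : Γ m = G)
    (hU : ∀ i, (Γ i).support ⊆ U i) (hg : ∀ i < m, ∃ x, Growth (Γ i) (Γ (i + 1)) x) :
    Achieves G U Γ m := by
  have hmain : ∀ H F, IsRun Γ m H F →
      (F m).ncard + 2 ≤ 5 * opt G ∨ (F m).ncard ≤ opt G := by
    intro H F hrun
    obtain ⟨S, hS, hcard⟩ := exists_isFVS_ncard_eq_opt G
    rw [← hcard]
    subst hm
    obtain ⟨A, hFA, hA⟩ := hrun.exists_charge h0 hg hS m le_rfl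
    have hsound := hrun.isSound h0 m le_rfl
    exact hsound.maximal.ncard_le hsound.subset hS hFA hA
  have hopt : opt G ≤ Fintype.card V := by
    obtain ⟨S, -, hcard⟩ := exists_isFVS_ncard_eq_opt G
    rw [← hcard, ← Nat.card_eq_fintype_card]
    exact Set.ncard_le_card S
  have hbound : ∀ H F, IsRun Γ m H F → 1 ≤ opt G →
      ((F m).ncard : ℝ) ≤ 5 * (opt G : ℝ) - 2 := by
    intro H F hrun h1
    have h2 : (F m).ncard + 2 ≤ 5 * opt G := by
      have := hmain H F hrun
      omega
    have h3 : ((F m).ncard : ℝ) + 2 ≤ 5 * opt G := by exact_mod_cast h2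
    linarith
  refine ⟨?_, ?_, ?_, hbound⟩
  · intro i hi H F hH
    obtain ⟨x, hx⟩ := hg i hi
    exact exists_step hx.le hH F
  · intro H F hrun
    refine ⟨fun i hi => ?_, fun i hi => ?_, fun i hi => (hrun.isSound h0 i hi).isFVS⟩
    · have hsound := hrun.isSound h0 i hi
      refine hsound.subset.trans fun v hv => hU i ?_
      obtain ⟨w, hw⟩ := hv
      exact ⟨w, hsound.maximal.1.1 hw⟩
    · obtain ⟨I, -, -, hI⟩ := (hrun.step i hi).update
      rw [hI]
      exact fun v hv => Or.inl (Or.inl (Or.inl hv))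
  · intro H F hrun
    rcases Nat.eq_zero_or_pos (opt G) with h | h
    · have h1 := hmain H F hrun
      have h2 : (F m).ncard = 0 := by omega
      simp [h, h2]
    · refine (hbound H F hrun h).trans ?_
      have hpos : (0 : ℝ) < Fintype.card V := by exact_mod_cast lt_of_lt_of_le h hopt
      have hle : (opt G : ℝ) / Fintype.card V ≤ 1 := by
        rw [div_le_one hpos]
        exact_mod_cast hopt
      have heq : (5 - 2 / (Fintype.card V : ℝ)) * (opt G : ℝ) =
          5 * opt G - 2 * (opt G / Fintype.card V) := by ring
      rw [heq]
      linarith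

lemma growth_vertexStage {n : ℕ} (G : SimpleGraph (Fin n)) {i : ℕ} (hi : i < n) :
    Growth (vertexStage G i) (vertexStage G (i + 1)) ⟨i, hi⟩ := by
  refine ⟨?_, ?_, ?_⟩
  · rintro a b ⟨hab, ha, hb⟩
    exact ⟨hab, Nat.lt_succ_of_lt ha, Nat.lt_succ_of_lt hb⟩
  · rintro a b ⟨hab, ha, hb⟩ hnot
    have ha' : (a : ℕ) < i + 1 := ha
    have hb' : (b : ℕ) < i + 1 := hb
    by_contra! hne
    have h1 : (a : ℕ) ≠ i := fun h => hne.1 (Fin.ext h)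
    have h2 : (b : ℕ) ≠ i := fun h => hne.2 (Fin.ext h)
    exact hnot ⟨hab, show (a : ℕ) < i by omega, show (b : ℕ) < i by omega⟩
  · rintro ⟨y, -, h, -⟩
    exact absurd h (lt_irrefl i)

lemma IsEdgewise.growth {V : Type*} {G : SimpleGraph V} {m : ℕ} {Γ : ℕ → SimpleGraph V}
    (h : IsEdgewise G m Γ) {i : ℕ} (hi : i < m) : ∃ x, Growth (Γ i) (Γ (i + 1)) x := by
  obtain ⟨e, -, hins⟩ := h.step i hi
  induction e with
  | _ x y =>
    have hadj : ∀ a b, (Γ (i + 1)).Adj a b ↔ s(a, b) = s(x, y) ∨ (Γ i).Adj a b := by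
      intro a b
      rw [← mem_edgeSet, hins]
      rfl
    have hnew : ∀ a b, (Γ (i + 1)).Adj a b → ¬ (Γ i).Adj a b → s(a, b) = s(x, y) :=
      fun a b hab hnot => ((hadj a b).1 hab).resolve_right hnot
    refine ⟨x, fun a b hab => (hadj a b).2 (Or.inr hab), fun a b hab hnot => ?_,
      fun _ => ⟨y, fun b hb hnot => ?_⟩⟩
    · rcases Sym2.eq_iff.1 (hnew a b hab hnot) with h | h
      · exact Or.inl h.1
      · exact Or.inr h.2
    · rcases Sym2.eq_iff.1 (hnew x b hb hnot) with h | h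
      · exact h.2
      · exact h.2.trans h.1

end DelayedFVS

theorem mainTheorem1 (n : ℕ) (G : SimpleGraph (Fin n)) :
    DelayedFVS.Achieves G (DelayedFVS.firstVertices n) (DelayedFVS.vertexStage G) n ∧
    ∀ (m : ℕ) (Γ : ℕ → SimpleGraph (Fin n)), DelayedFVS.IsEdgewise G m Γ →
      DelayedFVS.Achieves G (fun i => (Γ i).support) Γ m := by
  refine ⟨DelayedFVS.achieves_of_growth ?_ ?_ ?_ ?_, fun m Γ h => ?_⟩
  · ext a b
    exact ⟨fun h => absurd h.2.1 (Nat.not_lt_zero _), fun h => h.elim⟩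
  · ext a b
    exact ⟨fun h => h.1, fun h => ⟨h, a.2, b.2⟩⟩
  · rintro i a ⟨b, h⟩
    exact h.2.1
  · exact fun i hi => ⟨_, DelayedFVS.growth_vertexStage G hi⟩
  · exact DelayedFVS.achieves_of_growth h.init h.final (fun _ => subset_rfl) fun i hi => h.growth hi
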